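/- Let $k_0$ be a perfect field, $k := k_0((x))$ with its $x$-adic topology, and let $k_0((x,y))$ denote the fraction field of $k_0[[x,y]]$. Let $L/K/k_0((x,y))$ be a tower of finite field extensions. Denote by $A$ and $B$ the integral closures of $k_0[[x,y]]$ in $K$ and $L$ respectively, and set $X := \operatorname{Spec} A[x^{-1}]$ and $Y := \operatorname{Spec} B[x^{-1}]$; these are $k$-schemes through $k_0[[x]] \subseteq k_0[[x,y]]$, and $A \subseteq B$ induces a natural $k$-morphism $f : Y \to X$. For a finite field extension $\ell/k$, equipped with its valuation topology (the unique Hausdorff topology making it a topological $k$-vector space), and an affine $k$-scheme $S$, let $S(\ell)$ be the set of $k$-morphisms $\operatorname{Spec}\ell \to S$, with the coarsest topology for which the function $g_* : S(\ell) \to \ell$ induced by $g$ is continuous for every $g \in \Gamma(S\otimes_k \ell, \mathcal{O})$. Let $v \in Y$ be a closed point, with residue field $k(v)$, such that $f$ is étale at $v$ (that is, étale on an open neighbourhood of $v$). Then $k(v)$ is a finite extension of $k$, and the map $f_v : Y(k(v)) \to X(k(v))$ induced by $f$ is a local homeomorphism at $v$, where $v$ is regarded as the element of $Y(k(v))$ given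 by the canonical morphism $\operatorname{Spec} k(v) \to Y$: there is an open neighbourhood $W$ of $v$ in $Y(k(v))$ such that $f_v(W)$ is open in $X(k(v))$ and $f_v$ restricts to a homeomorphism $W \to f_v(W)$. -/

import Mathlib

open scoped LaurentSeries PowerSeries TensorProduct

noncomputable section

namespace ImplicitFunction

/-- The ring `k₀[[x, y]]`, with `x = X 0` and `y = X 1`. -/
abbrev PS2 (k₀ : Type*) [Field k₀] : Type _ := MvPowerSeries (Fin 2) k₀

/-- The field `k₀((x, y))`, the fraction field of `k₀[[x, y]]`. -/
abbrev LS2 (k₀ : Type*) [Field k₀] : Type _ := FractionRing (PS2 k₀)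

/-- The inclusion `k₀[[x]] → k₀[[x, y]]` that sends the variable to `x`. -/
def inclX (k₀ : Type*) [Field k₀] : k₀⟦X⟧ →+* PS2 k₀ :=
  (PowerSeries.substAlgHom (R := k₀) (S := k₀)
    (PowerSeries.HasSubst.X (S := k₀) (0 : Fin 2))).toRingHom

theorem inclX_X (k₀ : Type*) [Field k₀] : inclX k₀ PowerSeries.X = MvPowerSeries.X 0 :=
  PowerSeries.substAlgHom_X _

/-- For `K` over `k₀[[x, y]]`, with `A` the integral closure of `k₀[[x, y]]` in `K`,
this is the ring `A[x⁻¹]`. -/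
abbrev CoordRing (k₀ K : Type*) [Field k₀] [Field K] [Algebra (PS2 k₀) K] : Type _ :=
  Localization.Away
    (algebraMap (PS2 k₀) (integralClosure (PS2 k₀) K) (MvPowerSeries.X 0))

section CoordRing

variable (k₀ K L : Type*) [Field k₀] [Field K] [Field L] [Algebra (PS2 k₀) K]
  [Algebra (PS2 k₀) L]

theorem isUnit_algebraMap_inclX : IsUnit
    (((algebraMap (PS2 k₀) (CoordRing k₀ K)).comp (inclX k₀)) PowerSeries.X) := by
  rw [RingHom.comp_apply, inclX_X,
    IsScalarTower.algebraMap_apply (PS2 k₀) (integralClosure (PS2 k₀) K) (CoordRing k₀ K)]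
  exact IsLocalization.Away.algebraMap_isUnit _

/-- The ring map `k₀((x)) → A[x⁻¹]` extending `k₀[[x]] → k₀[[x, y]] → A[x⁻¹]`. -/
def structureMap : k₀⸨X⸩ →+* CoordRing k₀ K :=
  IsLocalization.Away.lift (S := k₀⸨X⸩) (PowerSeries.X : k₀⟦X⟧) (isUnit_algebraMap_inclX k₀ K)

/-- The `k₀((x))`-algebra structure of `A[x⁻¹]`. -/
instance coordRingAlgebra : Algebra k₀⸨X⸩ (CoordRing k₀ K) := (structureMap k₀ K).toAlgebra

variable [Algebra K L] [IsScalarTower (PS2 k₀) K L]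

/-- The inclusion `A → B` of the integral closures of `k₀[[x, y]]` in `K ⊆ L`. -/
def integralClosureMap :
    integralClosure (PS2 k₀) K →ₐ[PS2 k₀] integralClosure (PS2 k₀) L :=
  (IsScalarTower.toAlgHom (PS2 k₀) K L).mapIntegralClosure

theorem isUnit_integralClosureMap : IsUnit
    (((algebraMap (integralClosure (PS2 k₀) L) (CoordRing k₀ L)).comp
      (integralClosureMap k₀ K L).toRingHom)
        (algebraMap (PS2 k₀) (integralClosure (PS2 k₀) K) (MvPowerSeries.X 0))) := by
  have h : (integralClosureMap k₀ K L).toRingHom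
      (algebraMap (PS2 k₀) (integralClosure (PS2 k₀) K) (MvPowerSeries.X 0)) =
      algebraMap (PS2 k₀) (integralClosure (PS2 k₀) L) (MvPowerSeries.X 0) :=
    (integralClosureMap k₀ K L).commutes _
  rw [RingHom.comp_apply, h]
  exact IsLocalization.Away.algebraMap_isUnit _

/-- The ring map `A[x⁻¹] → B[x⁻¹]` induced by the inclusion `A → B`. -/
def coordRingHom : CoordRing k₀ K →+* CoordRing k₀ L :=
  IsLocalization.Away.lift _ (isUnit_integralClosureMap k₀ K L)

theorem coordRingHom_comp_structureMap :
    (coordRingHom k₀ K L).comp (structureMap k₀ K) = structureMap k₀ L := by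
  refine IsLocalization.ringHom_ext (Submonoid.powers (PowerSeries.X : k₀⟦X⟧)) ?_
  ext p
  simp only [RingHom.comp_apply, structureMap, IsLocalization.Away.lift_eq]
  rw [IsScalarTower.algebraMap_apply (PS2 k₀) (integralClosure (PS2 k₀) K) (CoordRing k₀ K),
    IsScalarTower.algebraMap_apply (PS2 k₀) (integralClosure (PS2 k₀) L) (CoordRing k₀ L),
    coordRingHom, IsLocalization.Away.lift_eq]
  exact congrArg (algebraMap (integralClosure (PS2 k₀) L) (CoordRing k₀ L))
    ((integralClosureMap k₀ K L).commutes (inclX k₀ p))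

/-- The map `A[x⁻¹] → B[x⁻¹]` as a map of `k₀((x))`-algebras; it is the comorphism of the
natural morphism `f : Spec B[x⁻¹] → Spec A[x⁻¹]` of `k₀((x))`-schemes. -/
def coordMap : CoordRing k₀ K →ₐ[k₀⸨X⸩] CoordRing k₀ L where
  __ := coordRingHom k₀ K L
  commutes' r := RingHom.congr_fun (coordRingHom_comp_structureMap k₀ K L) r

end CoordRing

/-- The morphism `Spec T → Spec S` given by `φ : S → T` is étale at the point `v`: its restriction
to some basic open neighbourhood `Spec T[1/g]` of `v` is étale. -/
def IsEtaleAtPoint {S T : Type*} [CommRing S] [CommRing T] (φ : S →+* T)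
    (v : PrimeSpectrum T) : Prop :=
  ∃ g : T, g ∉ v.asIdeal ∧ ((algebraMap T (Localization.Away g)).comp φ).Etale

section Points

variable (k S ℓ : Type*) [Field k] [CommRing S] [Algebra k S] [Field ℓ] [Algebra k ℓ]

/-- The set `X(ℓ)` of `ℓ`-points of the affine `k`-scheme `X = Spec S`: morphisms of `k`-schemes
`Spec ℓ → X`, that is, `k`-algebra maps `S → ℓ`. -/
def Points : Type _ := S →ₐ[k] ℓ

variable {k S ℓ}

/-- The function `g_* : X(ℓ) → ℓ` induced by a section `g` of the base change `X ⊗ ℓ`. -/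
def Points.eval (g : ℓ ⊗[k] S) (p : Points k S ℓ) : ℓ :=
  Algebra.TensorProduct.lift (Algebra.ofId ℓ ℓ) (show S →ₐ[k] ℓ from p)
    (fun _ _ => Commute.all _ _) g

/-- The topology of `X(ℓ)`: the coarsest one for which all functions `g_*` are continuous, where
`ℓ` has its topology as a `k`-module. For `ℓ` finite over a complete valued field `k`, the latter is
the unique Hausdorff topology that makes `ℓ` a topological `k`-vector space, and it is the topology
of the valuation of `ℓ`. -/
instance Points.topology [TopologicalSpace k] : TopologicalSpace (Points k S ℓ) :=
  ⨅ g : ℓ ⊗[k] S, TopologicalSpace.induced (Points.eval g) (moduleTopology k ℓ)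

/-- The map `f_ℓ : Y(ℓ) → X(ℓ)` induced by the morphism `f : Y = Spec T → X = Spec S` with
comorphism `φ`. -/
def Points.map {T : Type*} [CommRing T] [Algebra k T] (φ : S →ₐ[k] T) (p : Points k T ℓ) :
    Points k S ℓ :=
  (show T →ₐ[k] ℓ from p).comp φ

/-- The point `v` of `X = Spec S`, viewed as an element of `X(k(v))`: the canonical morphism
`Spec k(v) → X`. -/
def Points.ofPrime (k : Type*) {S : Type*} [Field k] [CommRing S] [Algebra k S]
    (v : PrimeSpectrum S) : Points k S v.asIdeal.ResidueField :=
  IsScalarTower.toAlgHom k S v.asIdeal.ResidueField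

end Points

end ImplicitFunction

end

/-! The rings `A[x⁻¹]` and `B[x⁻¹]` are not of finite type over `k`, so there is no affine space in
which to apply the implicit function theorem directly. But `X(ℓ)` carries the topology of pointwise
convergence on functions (`Points.isInducing`), and near `v` the étale map is standard étale: a
point of `Y` over `φ ∈ X(ℓ)` is a root `t` of one polynomial `f` specialised at `φ`, with `g(t) ≠
0`, and such roots are simple. Only the finitely many coefficients of `f` enter the equation, so the
implicit function theorem over the complete field `ℓ` makes the root a continuous function of `φ`
(`isLocalHomeomorph_map_of_standardEtale`).

It remains to see that `κ = k(v)` is finite over `k`, hence complete. The kernel `p` of `k₀[[x, y]]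
→ κ` is nonzero: otherwise some `xⁿ / y` in `κ` would be integral over `k₀[[x, y]]`, which setting
`y = 0` in its equation refutes (`ker_baseHom_ne_bot`). Since `x ∉ p`, Weierstrass preparation shows
that `p = (q)` is principal and that `k₀[[x, y]] / p` is finite over `k₀[[x]]`. The image of the
base thus generates a field `κ'` finite over `k`. Elements of `κ` independent over `κ'` lift, up to
powers of `x`, to elements of `B` independent over `k₀((x, y))`: a relation not divisible by `q`
stays nontrivial modulo `q`. So `[κ : κ'] ≤ [L : k₀((x, y))]`, without using that `B` is a finite
module. -/

noncomputable section

namespace ImplicitFunction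

/-! ### Topology on sets of points -/

section PointsTopology

variable {k S ℓ : Type*} [Field k] [CommRing S] [Algebra k S] [Field ℓ] [Algebra k ℓ]

/-- A point of `Spec S` as a map of algebras. -/
def Points.toAlgHom (p : Points k S ℓ) : S →ₐ[k] ℓ := p

theorem Points.toAlgHom_injective :
    Function.Injective (Points.toAlgHom : Points k S ℓ → S →ₐ[k] ℓ) := fun _ _ h ↦ h

theorem Points.eval_tmul (c : ℓ) (s : S) (p : Points k S ℓ) :
    p.eval (c ⊗ₜ[k] s) = c * p.toAlgHom s := by
  simp only [Points.eval]
  rfl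

variable [TopologicalSpace k] [TopologicalSpace ℓ] [IsModuleTopology k ℓ]

theorem Points.continuous_toAlgHom_apply (s : S) :
    Continuous fun p : Points k S ℓ ↦ p.toAlgHom s := by
  have h : (fun p : Points k S ℓ ↦ p.toAlgHom s) = Points.eval (1 ⊗ₜ[k] s) := by
    ext p
    rw [Points.eval_tmul, one_mul]
  rw [h, continuous_iff_le_induced]
  refine (iInf_le _ (1 ⊗ₜ[k] s)).trans ?_
  rw [← eq_moduleTopology k ℓ]

variable [IsTopologicalRing ℓ]

/-- The topology of the set of points is the topology of pointwise convergence. -/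
theorem Points.isInducing :
    Topology.IsInducing fun (p : Points k S ℓ) (s : S) ↦ p.toAlgHom s := by
  refine ⟨le_antisymm (continuous_iff_le_induced.mp
    (continuous_pi Points.continuous_toAlgHom_apply)) (le_iInf fun g ↦ ?_)⟩
  rw [← eq_moduleTopology k ℓ, ← continuous_iff_le_induced]
  -- From here on, continuity refers to pointwise convergence; additivity reduces `g_*` to pure
  -- tensors.
  let : TopologicalSpace (Points k S ℓ) :=
    TopologicalSpace.induced (fun (p : Points k S ℓ) (s : S) ↦ p.toAlgHom s) inferInstance
  have hc : ∀ s : S, Continuous fun p : Points k S ℓ ↦ p.toAlgHom s := fun s ↦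
    (continuous_apply s).comp continuous_induced_dom
  change Continuous (Points.eval g)
  induction g using TensorProduct.induction_on with
  | zero =>
    have h : Points.eval 0 = fun _ : Points k S ℓ ↦ (0 : ℓ) := by
      ext p
      simp [Points.eval]
    rw [h]
    exact continuous_const
  | tmul c s =>
    have h : Points.eval (c ⊗ₜ[k] s) = fun p : Points k S ℓ ↦ c * p.toAlgHom s :=
      funext (Points.eval_tmul c s)
    rw [h]
    exact continuous_const.mul (hc s)
  | add a b ha hb =>
    have h : Points.eval (a + b) = fun p : Points k S ℓ ↦ p.eval a + p.eval b := by
      ext p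
      simp [Points.eval]
    rw [h]
    exact ha.add hb

theorem Points.continuous_map {T : Type*} [CommRing T] [Algebra k T] (φ : S →ₐ[k] T) :
    Continuous (Points.map φ : Points k T ℓ → Points k S ℓ) :=
  Points.isInducing.continuous_iff.mpr <| continuous_pi fun s ↦
    Points.continuous_toAlgHom_apply (φ s)

/-- Points of a basic open subscheme form an open subspace. -/
theorem Points.isOpenEmbedding_map_of_isLocalization {T U : Type*} [CommRing T] [CommRing U]
    [Algebra k T] [Algebra k U] [Algebra T U] [IsScalarTower k T U] (g : T)
    [IsLocalization.Away g U] [ContinuousInv₀ ℓ] [T1Space ℓ] :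
    Topology.IsOpenEmbedding
      (Points.map (IsScalarTower.toAlgHom k T U) : Points k U ℓ → Points k T ℓ) := by
  have hg : ∀ p : Points k U ℓ, p.toAlgHom (algebraMap T U g) ≠ 0 := fun p ↦
    ((IsLocalization.Away.algebraMap_isUnit g).map p.toAlgHom).ne_zero
  refine ⟨⟨⟨le_antisymm (continuous_iff_le_induced.mp (Points.continuous_map _)) ?_⟩, ?_⟩, ?_⟩
  · conv_rhs => rw [Points.isInducing.eq_induced]
    rw [← continuous_iff_le_induced]
    let τ : TopologicalSpace (Points k U ℓ) := TopologicalSpace.induced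
      (Points.map (IsScalarTower.toAlgHom k T U)) (Points.topology (k := k) (S := T))
    have hc : ∀ t : T, Continuous fun p : Points k U ℓ ↦ p.toAlgHom (algebraMap T U t) :=
      fun t ↦ (Points.continuous_toAlgHom_apply (k := k) (S := T) t).comp
        (continuous_induced_dom (f := Points.map (IsScalarTower.toAlgHom k T U)))
    refine continuous_pi fun u ↦ ?_
    -- Each `u` is a fraction `t / gⁿ`, and inversion is continuous away from zero.
    obtain ⟨n, t, h⟩ := IsLocalization.Away.surj g u
    have h' : (fun p : Points k U ℓ ↦ p.toAlgHom u) = fun p ↦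
        p.toAlgHom (algebraMap T U t) * (p.toAlgHom (algebraMap T U g) ^ n)⁻¹ := by
      ext p
      rw [← h, map_mul, map_pow, mul_assoc, mul_inv_cancel₀ (pow_ne_zero _ (hg p)), mul_one]
    rw [h']
    exact (hc t).mul (((hc g).pow n).inv₀ fun p ↦ pow_ne_zero _ (hg p))
  · intro p q hpq
    refine Points.toAlgHom_injective (AlgHom.coe_ringHom_injective ?_)
    refine IsLocalization.ringHom_ext (Submonoid.powers g) (RingHom.ext fun t ↦ ?_)
    exact congrArg (fun r : Points k T ℓ ↦ r.toAlgHom t) hpq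
  · have hr : Set.range (Points.map (IsScalarTower.toAlgHom k T U) :
        Points k U ℓ → Points k T ℓ) = {p | p.toAlgHom g ≠ 0} := by
      ext p
      refine ⟨?_, fun hp ↦ ?_⟩
      · rintro ⟨q, rfl⟩
        exact hg q
      · have hu : ∀ y : Submonoid.powers g, IsUnit (p.toAlgHom y) := by
          rintro ⟨_, n, rfl⟩
          exact (isUnit_iff_ne_zero.mpr (by simpa using pow_ne_zero n hp))
        refine ⟨IsLocalization.liftAlgHom (M := Submonoid.powers g) (f := p.toAlgHom) hu, ?_⟩
        refine Points.toAlgHom_injective (AlgHom.ext fun t ↦ ?_)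
        exact IsLocalization.lift_eq hu t
    rw [hr]
    exact isOpen_ne.preimage (Points.continuous_toAlgHom_apply g)

end PointsTopology

/-! ### Implicit function theorem for a simple root -/

section ImplicitRoot

variable {𝕜 : Type*} [NontriviallyNormedField 𝕜] [CompleteSpace 𝕜]

/-- The equation of a simple root, `(a, t) ↦ (a, ∑ aᵢ tⁱ)`, is a local homeomorphism. -/
theorem exists_openPartialHomeomorph_polynomial {n : ℕ} (a : Fin n → 𝕜) (t : 𝕜)
    (h : ∑ i : Fin n, a i * (i * t ^ (i - 1 : ℕ)) ≠ 0) :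
    ∃ G : OpenPartialHomeomorph ((Fin n → 𝕜) × 𝕜) ((Fin n → 𝕜) × 𝕜),
      (a, t) ∈ G.source ∧ ∀ z, G z = (z.1, ∑ i : Fin n, z.1 i * z.2 ^ (i : ℕ)) := by
  let fstL : (Fin n → 𝕜) × 𝕜 →L[𝕜] (Fin n → 𝕜) := ContinuousLinearMap.fst 𝕜 _ _
  let sndL : (Fin n → 𝕜) × 𝕜 →L[𝕜] 𝕜 := ContinuousLinearMap.snd 𝕜 _ _
  let coordL (i : Fin n) : (Fin n → 𝕜) × 𝕜 →L[𝕜] 𝕜 := (ContinuousLinearMap.proj i).comp fstL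
  let d : 𝕜 := ∑ i : Fin n, a i * (i * t ^ (i - 1 : ℕ))
  -- `D` is the differential of the sum at `(a, t)`. Its partial derivative `d` in `t` is nonzero,
  -- so `D` can be solved for the last coordinate, which gives `D'` below.
  let D : (Fin n → 𝕜) × 𝕜 →L[𝕜] 𝕜 :=
    ∑ i : Fin n, (a i • ((i * t ^ (i - 1 : ℕ)) • sndL) + t ^ (i : ℕ) • coordL i)
  have hD : ∀ z : (Fin n → 𝕜) × 𝕜, D z = d * z.2 + ∑ i : Fin n, t ^ (i : ℕ) * z.1 i := by
    intro z
    simp [D, d, sndL, coordL, fstL, Finset.sum_add_distrib, Finset.sum_mul, mul_assoc]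
  let D' : (Fin n → 𝕜) × 𝕜 →L[𝕜] 𝕜 := d⁻¹ • (sndL - ∑ i : Fin n, t ^ (i : ℕ) • coordL i)
  have hD' : ∀ z : (Fin n → 𝕜) × 𝕜, D' z = d⁻¹ * (z.2 - ∑ i : Fin n, t ^ (i : ℕ) * z.1 i) := by
    intro z
    simp [D', sndL, coordL, fstL]
  let e : ((Fin n → 𝕜) × 𝕜) ≃L[𝕜] (Fin n → 𝕜) × 𝕜 :=
    ContinuousLinearEquiv.equivOfInverse (fstL.prod D) (fstL.prod D')
    (fun z ↦ by
      refine Prod.ext rfl ?_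
      change D' (z.1, D z) = z.2
      rw [hD', hD]
      change d⁻¹ * (d * z.2 + _ - _) = z.2
      rw [add_sub_cancel_right, inv_mul_cancel_left₀ h])
    (fun z ↦ by
      refine Prod.ext rfl ?_
      change D (z.1, D' z) = z.2
      rw [hD, hD']
      change d * (d⁻¹ * (z.2 - _)) + _ = z.2
      rw [mul_inv_cancel_left₀ h, sub_add_cancel])
  have hF : HasStrictFDerivAt (fun z : (Fin n → 𝕜) × 𝕜 ↦ (z.1, ∑ i : Fin n, z.1 i * z.2 ^ (i : ℕ)))
      (e : (Fin n → 𝕜) × 𝕜 →L[𝕜] (Fin n → 𝕜) × 𝕜) (a, t) := by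
    refine HasStrictFDerivAt.prodMk (f₁' := fstL) (f₂' := D) fstL.hasStrictFDerivAt ?_
    refine HasStrictFDerivAt.fun_sum fun i _ ↦ ?_
    have h1 : HasStrictFDerivAt (fun z : (Fin n → 𝕜) × 𝕜 ↦ z.1 i) (coordL i) (a, t) :=
      (coordL i).hasStrictFDerivAt
    have h2 : HasStrictFDerivAt (fun z : (Fin n → 𝕜) × 𝕜 ↦ z.2) sndL (a, t) :=
      sndL.hasStrictFDerivAt
    simpa using h1.fun_mul (h2.pow (i : ℕ))
  exact ⟨hF.toOpenPartialHomeomorph _, hF.mem_toOpenPartialHomeomorph_source, fun z ↦ rfl⟩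

end ImplicitRoot

/-! ### Standard étale and étale morphisms -/

section StandardEtale

variable {k S U ℓ : Type*} [Field k] [CommRing S] [Algebra k S] [CommRing U] [Algebra k U]
  [Algebra S U] [IsScalarTower k S U] (P : StandardEtalePresentation S U)

theorem toAlgHom_aeval [Field ℓ] [Algebra k ℓ] (p : Points k U ℓ) (q : Polynomial S) (u : U) :
    p.toAlgHom (Polynomial.aeval u q) =
      q.eval₂ ((p.map (IsScalarTower.toAlgHom k S U)).toAlgHom : S →+* ℓ) (p.toAlgHom u) := by
  rw [Polynomial.aeval_def, ← AlgHom.coe_toRingHom, Polynomial.hom_eval₂]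
  rfl

/-- A point of the base and a root of the equation give a point of a standard étale algebra. -/
theorem exists_point_of_root [Field ℓ] [Algebra k ℓ] (φ : Points k S ℓ) (t : ℓ)
    (hf : P.f.eval₂ (φ.toAlgHom : S →+* ℓ) t = 0) (hg : P.g.eval₂ (φ.toAlgHom : S →+* ℓ) t ≠ 0) :
    ∃ p : Points k U ℓ, p.map (IsScalarTower.toAlgHom k S U) = φ ∧ p.toAlgHom P.x = t := by
  let : Algebra S ℓ := (φ.toAlgHom : S →+* ℓ).toAlgebra
  have : IsScalarTower k S ℓ := IsScalarTower.of_algebraMap_eq fun c ↦ (φ.toAlgHom.commutes c).symm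
  have hm : P.HasMap t := ⟨hf, isUnit_iff_ne_zero.mpr hg⟩
  let p : U →ₐ[S] ℓ := (P.lift t hm).comp P.equivRing.toAlgHom
  refine ⟨p.restrictScalars k, ?_, ?_⟩
  · exact Points.toAlgHom_injective (AlgHom.ext fun s ↦ p.commutes s)
  · change P.lift t hm (P.equivRing P.x) = t
    rw [P.equivRing_x, P.lift_X]

theorem point_ext [Field ℓ] [Algebra k ℓ] {p q : Points k U ℓ}
    (h : p.map (IsScalarTower.toAlgHom k S U) = q.map (IsScalarTower.toAlgHom k S U))
    (hx : p.toAlgHom P.x = q.toAlgHom P.x) : p = q := by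
  let : Algebra S ℓ :=
    ((p.map (IsScalarTower.toAlgHom k S U)).toAlgHom : S →+* ℓ).toAlgebra
  let p' : U →ₐ[S] ℓ := { p.toAlgHom with commutes' := fun s ↦ rfl }
  let q' : U →ₐ[S] ℓ :=
    { q.toAlgHom with
      commutes' := fun s ↦ congrArg (fun r : Points k S ℓ ↦ r.toAlgHom s) h.symm }
  have : p' = q' := P.hom_ext hx
  exact Points.toAlgHom_injective (AlgHom.ext fun u ↦ DFunLike.congr_fun this u)

theorem Points.continuous_eval₂ [TopologicalSpace k] [Field ℓ] [Algebra k ℓ] [TopologicalSpace ℓ]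
    [IsTopologicalRing ℓ] [IsModuleTopology k ℓ] (q : Polynomial S) :
    Continuous fun z : Points k S ℓ × ℓ ↦ q.eval₂ (z.1.toAlgHom : S →+* ℓ) z.2 := by
  simp only [Polynomial.eval₂_eq_sum_range]
  exact continuous_finsetSum _ fun i _ ↦
    ((Points.continuous_toAlgHom_apply _).comp continuous_fst).mul (continuous_snd.pow i)

/-- A standard étale morphism induces a local homeomorphism on points with values in a complete
valued field. -/
theorem isLocalHomeomorph_map_of_standardEtale [TopologicalSpace k] [NontriviallyNormedField ℓ]
    [CompleteSpace ℓ] [Algebra k ℓ] [IsModuleTopology k ℓ] [Algebra.IsStandardEtale S U] :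
    IsLocalHomeomorph
      (Points.map (IsScalarTower.toAlgHom k S U) : Points k U ℓ → Points k S ℓ) := by
  obtain ⟨P⟩ := Algebra.IsStandardEtale.nonempty_standardEtalePresentation (R := S) (S := U)
  set π : Points k U ℓ → Points k S ℓ := Points.map (IsScalarTower.toAlgHom k S U) with hπ
  have hπc : Continuous π := Points.continuous_map _
  refine IsLocalHomeomorph.mk _ fun p₀ ↦ ?_
  -- All coefficients, the leading one included, serve as parameters.
  let n := P.f.natDegree + 1
  let a : Points k S ℓ → Fin n → ℓ := fun φ i ↦ φ.toAlgHom (P.f.coeff i)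
  have ha : Continuous a := continuous_pi fun i ↦ Points.continuous_toAlgHom_apply _
  have hsum : ∀ (φ : Points k S ℓ) (t : ℓ), ∑ i : Fin n, a φ i * t ^ (i : ℕ) =
      P.f.eval₂ (φ.toAlgHom : S →+* ℓ) t := by
    intro φ t
    rw [Polynomial.eval₂_eq_sum_range, Finset.sum_range]
    rfl
  have hder : ∀ (φ : Points k S ℓ) (t : ℓ), ∑ i : Fin n, a φ i * (i * t ^ (i - 1 : ℕ)) =
      P.f.derivative.eval₂ (φ.toAlgHom : S →+* ℓ) t := by
    intro φ t
    rw [← Polynomial.eval_map, ← Polynomial.derivative_map, Polynomial.derivative_eval,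
      Polynomial.sum_over_range' _ (by simp) n
        (Nat.lt_succ_of_le Polynomial.natDegree_map_le), Finset.sum_range]
    exact Finset.sum_congr rfl fun i _ ↦ by simp [a, mul_assoc]
  have hroot : ∀ p : Points k U ℓ,
      P.f.eval₂ ((π p).toAlgHom : S →+* ℓ) (p.toAlgHom P.x) = 0 := by
    intro p
    rw [← toAlgHom_aeval, P.hasMap.1, map_zero]
  have hunit : ∀ p : Points k U ℓ,
      P.g.eval₂ ((π p).toAlgHom : S →+* ℓ) (p.toAlgHom P.x) ≠ 0 := by
    intro p
    rw [← toAlgHom_aeval]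
    exact (P.hasMap.2.map p.toAlgHom).ne_zero
  obtain ⟨G, hG₀, hG⟩ := exists_openPartialHomeomorph_polynomial (a (π p₀)) (p₀.toAlgHom P.x) (by
    rw [hder, ← toAlgHom_aeval]
    exact (P.hasMap.isUnit_derivative_f.map p₀.toAlgHom).ne_zero)
  -- The implicit function: the root near `p₀.toAlgHom P.x` of the equation specialised at `φ`.
  let root : Points k S ℓ → ℓ := fun φ ↦ (G.symm (a φ, 0)).2
  have hGsymm : ∀ φ, (a φ, (0 : ℓ)) ∈ G.target → G.symm (a φ, 0) = (a φ, root φ) := by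
    intro φ hφ
    have h := G.right_inv hφ
    rw [hG] at h
    exact Prod.ext (Prod.mk.inj h).1 rfl
  have hrootf : ∀ φ, (a φ, (0 : ℓ)) ∈ G.target →
      P.f.eval₂ (φ.toAlgHom : S →+* ℓ) (root φ) = 0 := by
    intro φ hφ
    have h := G.right_inv hφ
    rw [hGsymm φ hφ, hG] at h
    rw [← hsum]
    exact congrArg Prod.snd h
  have hGp : ∀ p : Points k U ℓ, G (a (π p), p.toAlgHom P.x) = (a (π p), 0) := by
    intro p
    rw [hG]
    exact Prod.ext rfl ((hsum _ _).trans (hroot p))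
  let V : Set (Points k S ℓ) := {φ | (a φ, (0 : ℓ)) ∈ G.target}
  have hV : IsOpen V := G.open_target.preimage (ha.prodMk continuous_const)
  have hrootc : ContinuousOn root V :=
    continuous_snd.comp_continuousOn
      (G.continuousOn_symm.comp (ha.prodMk continuous_const).continuousOn fun φ hφ ↦ hφ)
  have hevc : ∀ q : Polynomial S,
      ContinuousOn (fun φ : Points k S ℓ ↦ q.eval₂ (φ.toAlgHom : S →+* ℓ) (root φ)) V := fun q ↦
    (Points.continuous_eval₂ q).comp_continuousOn (continuousOn_id.prodMk hrootc)
  let V' : Set (Points k S ℓ) := V ∩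
    (fun φ : Points k S ℓ ↦ P.g.eval₂ (φ.toAlgHom : S →+* ℓ) (root φ)) ⁻¹' {0}ᶜ
  have hV' : IsOpen V' := (hevc P.g).isOpen_inter_preimage hV isOpen_compl_singleton
  have hex : ∀ φ, ∃ p : Points k U ℓ, φ ∈ V' → π p = φ ∧ p.toAlgHom P.x = root φ := by
    intro φ
    by_cases hφ : φ ∈ V'
    · obtain ⟨p, hp⟩ := exists_point_of_root P φ (root φ) (hrootf φ hφ.1) hφ.2
      exact ⟨p, fun _ ↦ hp⟩
    · exact ⟨p₀, fun h ↦ absurd h hφ⟩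
  choose inv hinv using hex
  have hrootp : ∀ p : Points k U ℓ, (a (π p), p.toAlgHom P.x) ∈ G.source →
      (a (π p), (0 : ℓ)) ∈ G.target ∧ root (π p) = p.toAlgHom P.x := by
    intro p hp
    refine ⟨hGp p ▸ G.map_source hp, ?_⟩
    have h := G.left_inv hp
    rw [hGp] at h
    exact congrArg Prod.snd h
  have hmaps : ∀ p : Points k U ℓ, (a (π p), p.toAlgHom P.x) ∈ G.source → π p ∈ V' := by
    intro p hp
    refine ⟨(hrootp p hp).1, ?_⟩
    change P.g.eval₂ _ (root (π p)) ≠ 0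
    rw [(hrootp p hp).2]
    exact hunit p
  refine ⟨
    { toFun := π
      invFun := inv
      source := {p | (a (π p), p.toAlgHom P.x) ∈ G.source}
      target := V'
      map_source' := hmaps
      map_target' := fun φ hφ ↦ ?_
      left_inv' := fun p hp ↦ ?_
      right_inv' := fun φ hφ ↦ (hinv φ hφ).1
      open_source := G.open_source.preimage
        ((ha.comp hπc).prodMk (Points.continuous_toAlgHom_apply _))
      open_target := hV'
      continuousOn_toFun := hπc.continuousOn
      continuousOn_invFun := ?_ }, hG₀, fun p hp ↦ rfl⟩
  · change (a (π (inv φ)), (inv φ).toAlgHom P.x) ∈ G.source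
    rw [(hinv φ hφ).1, (hinv φ hφ).2, ← hGsymm φ hφ.1]
    exact G.map_target hφ.1
  · have h := hinv (π p) (hmaps p hp)
    exact point_ext P h.1 (h.2.trans (hrootp p hp).2)
  · refine Points.isInducing.continuousOn_iff.mpr (continuousOn_pi.mpr fun u ↦ ?_)
    -- Every function on `U` is a fraction `q(x) / g(x)ᵐ`, so its value at `inv φ` depends
    -- continuously on `φ` through the root.
    obtain ⟨q, m, hq⟩ := P.exists_mul_aeval_x_g_pow_eq_aeval_x u
    have hc : ContinuousOn (fun φ : Points k S ℓ ↦
        q.eval₂ (φ.toAlgHom : S →+* ℓ) (root φ) *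
          (P.g.eval₂ (φ.toAlgHom : S →+* ℓ) (root φ) ^ m)⁻¹) V' :=
      ((hevc q).mono Set.inter_subset_left).mul
        ((((hevc P.g).mono Set.inter_subset_left).pow m).inv₀ fun φ hφ ↦ pow_ne_zero m hφ.2)
    refine hc.congr fun φ hφ ↦ ?_
    have h := hinv φ hφ
    have hq' := congrArg (inv φ).toAlgHom hq
    rw [map_mul, map_pow, toAlgHom_aeval, toAlgHom_aeval, ← hπ, h.1, h.2] at hq'
    change (inv φ).toAlgHom u =
      q.eval₂ _ (root φ) * (P.g.eval₂ (φ.toAlgHom : S →+* ℓ) (root φ) ^ m)⁻¹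
    rw [← hq', mul_assoc, mul_inv_cancel₀ (pow_ne_zero m hφ.2), mul_one]

end StandardEtale

/-- An étale morphism induces a local homeomorphism on points with values in a complete valued
field, with no finiteness assumption on the source and the target. -/
theorem isLocalHomeomorphOn_map_of_etale {k S T ℓ : Type*} [Field k] [TopologicalSpace k]
    [CommRing S] [Algebra k S] [CommRing T] [Algebra k T] [NontriviallyNormedField ℓ]
    [CompleteSpace ℓ] [Algebra k ℓ] [IsModuleTopology k ℓ] (φ : S →ₐ[k] T) (p : Points k T ℓ)
    (g : T) (hg : p.toAlgHom g ≠ 0)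
    (het : ((algebraMap T (Localization.Away g)).comp φ.toRingHom).Etale) :
    IsLocalHomeomorphOn (Points.map (ℓ := ℓ) φ) {p} := by
  let : Algebra S T := φ.toRingHom.toAlgebra
  have : IsScalarTower k S T := IsScalarTower.of_algebraMap_eq fun c ↦ (φ.commutes c).symm
  have hST : Algebra.Etale S (Localization.Away g) := by
    rw [← RingHom.etale_algebraMap,
      IsScalarTower.algebraMap_eq S T (Localization.Away g)]
    exact het
  have hj := Points.isOpenEmbedding_map_of_isLocalization (k := k) (ℓ := ℓ)
    (U := Localization.Away g) g
  have lift_point : ∀ {R : Type _} [CommRing R] [Algebra k R] (p : Points k R ℓ) (g : R),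
      p.toAlgHom g ≠ 0 → ∃ q : Points k (Localization.Away g) ℓ,
        q.map (IsScalarTower.toAlgHom k R (Localization.Away g)) = p := by
    intro R _ _ p g hg
    have hu : ∀ y : Submonoid.powers g, IsUnit (p.toAlgHom y) := by
      rintro ⟨_, n, rfl⟩
      exact isUnit_iff_ne_zero.mpr (by simpa using pow_ne_zero n hg)
    exact ⟨IsLocalization.liftAlgHom (M := Submonoid.powers g) (f := p.toAlgHom) hu,
      Points.toAlgHom_injective (AlgHom.ext fun t ↦ IsLocalization.lift_eq hu t)⟩
  obtain ⟨q, rfl⟩ := lift_point p g hg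
  have hQ : (RingHom.ker q.toAlgHom).IsPrime := RingHom.ker_isPrime _
  -- As `f` lies outside the kernel of `q`, the point `q` extends to the standard étale
  -- neighbourhood.
  obtain ⟨f, hf, hstd⟩ := Algebra.IsEtaleAt.exists_isStandardEtale (R := S)
    (RingHom.ker q.toAlgHom)
  obtain ⟨r, rfl⟩ := lift_point q f hf
  have hi := Points.isOpenEmbedding_map_of_isLocalization (k := k) (ℓ := ℓ)
    (U := Localization.Away f) f
  have hloc := isLocalHomeomorph_map_of_standardEtale (k := k) (S := S)
    (U := Localization.Away f) (ℓ := ℓ)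
  have hcomp : (Points.map (IsScalarTower.toAlgHom k S (Localization.Away f)) :
      Points k (Localization.Away f) ℓ → Points k S ℓ) = Points.map φ ∘
      (Points.map (IsScalarTower.toAlgHom k T (Localization.Away g)) ∘
        Points.map (IsScalarTower.toAlgHom k (Localization.Away g) (Localization.Away f))) := by
    ext r
    refine Points.toAlgHom_injective (AlgHom.ext fun s ↦ congrArg r.toAlgHom ?_)
    change algebraMap S (Localization.Away f) s = algebraMap _ _ (algebraMap _ _ (algebraMap S T s))
    rw [← IsScalarTower.algebraMap_apply S T, ← IsScalarTower.algebraMap_apply S]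
  rw [hcomp] at hloc
  -- The open embeddings of the two localizations cancel from the composite.
  have := (hloc.isLocalHomeomorphOn.mono (Set.subset_univ {r})).of_comp_right
    (((hj.comp hi).isLocalHomeomorph.isLocalHomeomorphOn).mono (Set.subset_univ {r}))
  simpa using this

/-! ### Weierstrass preparation and prime ideals of `k₀[[x]][[y]]` -/

/-- The quotient agrees with that of `A[y]` by the distinguished polynomial `f`, which is monic. -/
theorem finite_quotient_of_weierstrassFactorization {A : Type*} [CommRing A] [IsLocalRing A]
    [IsAdicComplete (IsLocalRing.maximalIdeal A) A] {g h : PowerSeries A} {f : Polynomial A}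
    (H : g.IsWeierstrassFactorization f h) :
    ((Ideal.Quotient.mk (Ideal.span {g})).comp (PowerSeries.C (R := A))).Finite := by
  have h1 : Module.Finite A (Polynomial A ⧸ Ideal.span {f}) :=
    H.isDistinguishedAt.monic.finite_quotient
  have h2 : Module.Finite A (PowerSeries A ⧸ Ideal.span {g}) :=
    Module.Finite.equiv
      (PowerSeries.IsWeierstrassFactorizationAt.algEquivQuotient H).toLinearEquiv
  exact RingHom.finite_algebraMap.mpr h2

section TwoVariables

variable (k₀ : Type*) [Field k₀]

instance isAdicComplete_powerSeries : IsAdicComplete (IsLocalRing.maximalIdeal k₀⟦X⟧) k₀⟦X⟧ := by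
  rw [PowerSeries.maximalIdeal_eq_span_X]
  infer_instance

/-- The bijection of `{0, 1}` with `Option Unit` that sends `1` to `none`. -/
def finTwoEquivOption : Fin 2 ≃ Option Unit where
  toFun i := if i = 0 then some () else none
  invFun o := o.elim 1 fun _ ↦ 0
  left_inv i := by fin_cases i <;> rfl
  right_inv o := by rcases o with _ | ⟨⟩ <;> rfl

/-- The isomorphism `k₀[[x, y]] ≃ k₀[[x]][[y]]`. -/
def iteratedEquiv : PS2 k₀ ≃ₐ[k₀] PowerSeries k₀⟦X⟧ :=
  (MvPowerSeries.renameEquiv k₀ finTwoEquivOption).trans (MvPowerSeries.optionEquivLeft Unit k₀)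

theorem iteratedEquiv_inclX (f : k₀⟦X⟧) : iteratedEquiv k₀ (inclX k₀ f) = PowerSeries.C f := by
  have h1 : inclX k₀ f = MvPowerSeries.rename (fun _ : Unit ↦ (0 : Fin 2)) f := by
    rw [MvPowerSeries.rename_eq_subst]
    exact congrFun (PowerSeries.coe_substAlgHom _) f
  have h2 : iteratedEquiv k₀ (inclX k₀ f) = MvPowerSeries.optionEquivLeft Unit k₀
      (MvPowerSeries.rename (Function.Embedding.some : Unit ↪ Option Unit) f) := by
    rw [h1]
    change MvPowerSeries.optionEquivLeft Unit k₀ (MvPowerSeries.rename finTwoEquivOption _) = _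
    rw [MvPowerSeries.rename_rename]
    rfl
  rw [h2]
  refine PowerSeries.ext fun n ↦ MvPowerSeries.ext fun m ↦ ?_
  rw [MvPowerSeries.coeff_coeff_optionEquivLeft]
  rcases Nat.eq_zero_or_pos n with rfl | hn
  · have hm : m.optionElim 0 = m.embDomain Function.Embedding.some := by
      ext o
      rcases o with _ | u
      · rw [Finsupp.embDomain_of_notMem_range _ _ _ (by simp)]
        simp
      · rw [Finsupp.optionElim_apply_some]
        exact (Finsupp.embDomain_apply_self Function.Embedding.some m u).symm
    rw [hm, MvPowerSeries.coeff_embDomain_rename, PowerSeries.coeff_zero_C]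
  · rw [PowerSeries.coeff_C, if_neg hn.ne', map_zero]
    refine MvPowerSeries.coeff_rename_eq_zero _ _ ?_
    rintro ⟨a, ha⟩
    have h0 := DFunLike.congr_fun ha none
    rw [Finsupp.mapDomain_of_notMem_range _ _ (by simp), Finsupp.optionElim_apply_none] at h0
    exact hn.ne h0

theorem iteratedEquiv_X_zero :
    iteratedEquiv k₀ (MvPowerSeries.X 0) = PowerSeries.C PowerSeries.X := by
  rw [← inclX_X, iteratedEquiv_inclX]

theorem iteratedEquiv_X_one :
    iteratedEquiv k₀ (MvPowerSeries.X 1) = PowerSeries.X := by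
  change MvPowerSeries.optionEquivLeft Unit k₀ (MvPowerSeries.rename finTwoEquivOption _) = _
  rw [MvPowerSeries.rename_X]
  exact MvPowerSeries.optionEquivLeft_X_none

variable {k₀}

/-- Weierstrass preparation needs a nonzero reduction modulo `x`. Removing the largest power of `x`
achieves it, since a series with all coefficients divisible by `x` is divisible by `x`. -/
theorem exists_eq_X_pow_mul {F : PowerSeries k₀⟦X⟧} (hF : F ≠ 0) :
    ∃ (n : ℕ) (F' : PowerSeries k₀⟦X⟧), F = PowerSeries.C PowerSeries.X ^ n * F' ∧
      F'.map (IsLocalRing.residue k₀⟦X⟧) ≠ 0 := by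
  have hu : ¬ IsUnit (PowerSeries.C (PowerSeries.X : k₀⟦X⟧) : PowerSeries k₀⟦X⟧) := by
    intro h
    have := h.map (PowerSeries.constantCoeff (R := k₀⟦X⟧))
    rw [PowerSeries.constantCoeff_C] at this
    exact PowerSeries.X_prime.not_isUnit this
  obtain ⟨F', h, hn⟩ := (FiniteMultiplicity.of_not_isUnit hu hF).exists_eq_pow_mul_and_not_dvd
  refine ⟨_, F', h, fun h0 ↦ hn ?_⟩
  have hc : ∀ i, ∃ c : k₀⟦X⟧, PowerSeries.coeff i F' = PowerSeries.X * c := by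
    intro i
    have := congrArg (PowerSeries.coeff i) h0
    rw [PowerSeries.coeff_map, map_zero, IsLocalRing.residue_eq_zero_iff,
      PowerSeries.maximalIdeal_eq_span_X, Ideal.mem_span_singleton] at this
    exact this
  choose c hc using hc
  refine ⟨PowerSeries.mk c, PowerSeries.ext fun i ↦ ?_⟩
  rw [PowerSeries.coeff_C_mul, PowerSeries.coeff_mk, hc]

variable {P : Ideal (PowerSeries k₀⟦X⟧)} [P.IsPrime]

/-- Weierstrass preparation inside a prime ideal that does not contain `x`. -/
theorem exists_weierstrassFactorization_mem (hx : PowerSeries.C PowerSeries.X ∉ P)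
    {F : PowerSeries k₀⟦X⟧} (hF : F ≠ 0) (hFP : F ∈ P) :
    ∃ (n : ℕ) (F' : PowerSeries k₀⟦X⟧) (f : Polynomial k₀⟦X⟧) (h : PowerSeries k₀⟦X⟧),
      F = PowerSeries.C PowerSeries.X ^ n * F' ∧ F'.IsWeierstrassFactorization f h ∧
      F' ∈ P ∧ (f : PowerSeries k₀⟦X⟧) ∈ P := by
  obtain ⟨n, F', hn, hF'⟩ := exists_eq_X_pow_mul hF
  obtain ⟨f, h, hfh⟩ := PowerSeries.exists_isWeierstrassFactorization hF'
  have hF'P : F' ∈ P := by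
    rw [hn] at hFP
    exact (Ideal.IsPrime.mem_or_mem ‹_› hFP).resolve_left
      fun h ↦ hx (Ideal.IsPrime.mem_of_pow_mem ‹_› _ h)
  refine ⟨n, F', f, h, hn, hfh, hF'P, ?_⟩
  have := hF'P
  rw [hfh.eq_mul] at this
  exact (Ideal.IsPrime.mem_or_mem ‹_› this).resolve_right
    fun hh ↦ Ideal.IsPrime.ne_top ‹_› (Ideal.eq_top_of_isUnit_mem _ hh hfh.isUnit)

/-- A nonzero prime ideal of `k₀[[x]][[y]]` that does not contain `x` has a quotient that is finite
over `k₀[[x]]`. -/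
theorem finite_quotient_of_X_notMem (hx : PowerSeries.C PowerSeries.X ∉ P) (hP : P ≠ ⊥) :
    ((Ideal.Quotient.mk P).comp (PowerSeries.C (R := k₀⟦X⟧))).Finite := by
  obtain ⟨F, hFP, hF⟩ := Submodule.exists_mem_ne_zero_of_ne_bot hP
  obtain ⟨n, F', f, h, -, hfh, hF'P, -⟩ := exists_weierstrassFactorization_mem hx hF hFP
  have hle : Ideal.span {F'} ≤ P := (Ideal.span_singleton_le_iff_mem P).mpr hF'P
  exact (RingHom.Finite.of_surjective (Ideal.Quotient.factor hle)
    (Ideal.Quotient.factor_surjective hle)).comp (finite_quotient_of_weierstrassFactorization hfh)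

/-- A nonzero prime ideal of `k₀[[x]][[y]]` that does not contain `x` is principal. -/
theorem exists_eq_span_of_X_notMem (hx : PowerSeries.C PowerSeries.X ∉ P) (hP : P ≠ ⊥) :
    ∃ q : PowerSeries k₀⟦X⟧, P = Ideal.span {q} := by
  classical
  -- The generator is a monic polynomial in `P` of least degree.
  have hex : ∃ d : ℕ, ∃ f : Polynomial k₀⟦X⟧,
      f.Monic ∧ (f : PowerSeries k₀⟦X⟧) ∈ P ∧ f.natDegree = d := by
    obtain ⟨F, hFP, hF⟩ := Submodule.exists_mem_ne_zero_of_ne_bot hP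
    obtain ⟨n, F', f, h, -, hfh, -, hfP⟩ := exists_weierstrassFactorization_mem hx hF hFP
    exact ⟨_, f, hfh.isDistinguishedAt.monic, hfP, rfl⟩
  obtain ⟨q, hqm, hqP, hqd⟩ := Nat.find_spec hex
  have hmin : ∀ f : Polynomial k₀⟦X⟧, f.Monic → (f : PowerSeries k₀⟦X⟧) ∈ P →
      q.natDegree ≤ f.natDegree := by
    intro f hfm hfP
    rw [hqd]
    exact Nat.find_min' hex ⟨f, hfm, hfP, rfl⟩
  have hdvd : ∀ f : Polynomial k₀⟦X⟧, (f : PowerSeries k₀⟦X⟧) ∈ P → q ∣ f := by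
    intro f hfP
    rw [← Polynomial.modByMonic_eq_zero_iff_dvd hqm]
    by_contra hr
    have hrP : ((f %ₘ q : Polynomial k₀⟦X⟧) : PowerSeries k₀⟦X⟧) ∈ P := by
      rw [Polynomial.modByMonic_eq_sub_mul_div f q, Polynomial.coe_sub, Polynomial.coe_mul]
      exact sub_mem hfP (Ideal.mul_mem_right _ _ hqP)
    -- A nonzero remainder need not be monic. Its Weierstrass polynomial `f'` is, and has as degree
    -- the order of `F'` modulo `x`, which is below the degree of `q`.
    obtain ⟨n, F', f', h, hn, hfh, -, hf'P⟩ := exists_weierstrassFactorization_mem hx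
      (by simpa using hr) hrP
    obtain ⟨i, hi⟩ : ∃ i, PowerSeries.coeff i (F'.map (IsLocalRing.residue k₀⟦X⟧)) ≠ 0 := by
      by_contra! h0
      exact hfh.map_ne_zero (PowerSeries.ext h0)
    have hiq : i < q.natDegree := by
      by_contra! hle
      refine hi ?_
      have h0 : (f %ₘ q).coeff i = 0 := Polynomial.coeff_eq_zero_of_degree_lt
        ((Polynomial.degree_modByMonic_lt f hqm).trans_le
          (Polynomial.degree_le_natDegree.trans (by exact_mod_cast hle)))
      have h1 := congrArg (PowerSeries.coeff i) hn
      rw [Polynomial.coeff_coe, h0, ← map_pow, PowerSeries.coeff_C_mul] at h1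
      rw [PowerSeries.coeff_map,
        (mul_eq_zero.mp h1.symm).resolve_left (pow_ne_zero _ PowerSeries.X_ne_zero), map_zero]
    have h2 := hmin f' hfh.isDistinguishedAt.monic hf'P
    rw [hfh.natDegree_eq_toNat_order_map] at h2
    have h3 := ENat.toNat_le_of_le_natCast (PowerSeries.order_le i hi)
    omega
  refine ⟨q, le_antisymm (fun F hFP ↦ ?_) ((Ideal.span_singleton_le_iff_mem P).mpr hqP)⟩
  rw [Ideal.mem_span_singleton]
  by_cases hF : F = 0
  · exact hF ▸ dvd_zero _
  obtain ⟨n, F', f, h, hn, hfh, -, hfP⟩ := exists_weierstrassFactorization_mem hx hF hFP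
  obtain ⟨g, hg⟩ := hdvd f hfP
  rw [hn, hfh.eq_mul, hg, Polynomial.coe_mul, mul_assoc]
  exact (dvd_mul_right _ _).mul_left _

end TwoVariables

/-! ### Finiteness of residue fields at closed points -/

/-- Used to make a linear relation primitive at `q`, so that it survives reduction; `n` is the least
multiplicity of `q` among the entries. -/
theorem exists_eq_pow_mul_and_exists_not_dvd {R ι : Type*} [CommRing R] [IsDomain R]
    [WfDvdMonoid R] {q : R} (hq : ¬ IsUnit q) {c : ι → R} (hc : c ≠ 0) :
    ∃ (n : ℕ) (u : ι → R), (∀ i, c i = q ^ n * u i) ∧ ∃ j, ¬ q ∣ u j := by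
  classical
  obtain ⟨i₀, hi₀⟩ := Function.ne_iff.mp hc
  have hex : ∃ n, ∃ i, ¬ q ^ (n + 1) ∣ c i := by
    obtain ⟨n, hn⟩ := FiniteMultiplicity.of_not_isUnit hq hi₀
    exact ⟨n, i₀, hn⟩
  obtain ⟨j, hj⟩ := Nat.find_spec hex
  have hdvd : ∀ i, q ^ Nat.find hex ∣ c i := by
    intro i
    rcases hn : Nat.find hex with _ | m
    · simp
    · by_contra hi
      exact Nat.find_min hex (m := m) (by omega) ⟨i, hi⟩
  choose u hu using hdvd
  refine ⟨_, u, hu, j, fun ⟨w, hw⟩ ↦ hj ⟨w, ?_⟩⟩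
  rw [hu j, hw, pow_succ, mul_assoc]

/-- The range of `j` is already closed under products, so the algebra it generates is its `k`-span,
and the images of generators of `A` over `O` span it. -/
theorem finite_adjoin_range {O A k κ : Type*} [CommRing O] [CommRing A] [Field k] [Field κ]
    [Algebra k κ] {φ : O →+* A} (hφ : φ.Finite) (σ : O →+* k) (j : A →+* κ)
    (h : ∀ c, j (φ c) = algebraMap k κ (σ c)) :
    Module.Finite k (Algebra.adjoin k (Set.range j)) := by
  let : Algebra O A := φ.toAlgebra
  have hfin : Module.Finite O A := hφ
  obtain ⟨s, hs⟩ := hfin.fg_top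
  have hmem : ∀ a, j a ∈ Submodule.span k (j '' s) := by
    intro a
    have ha : a ∈ Submodule.span O (s : Set A) := hs ▸ Submodule.mem_top
    induction ha using Submodule.span_induction with
    | mem a ha => exact Submodule.subset_span ⟨a, ha, rfl⟩
    | zero => simp
    | add a b _ _ ha hb => rw [map_add]; exact add_mem ha hb
    | smul c a _ ha =>
      have hc : j (c • a) = σ c • j a := by
        rw [Algebra.smul_def, map_mul, Algebra.smul_def, ← h]
        rfl
      rw [hc]
      exact Submodule.smul_mem _ _ ha
  have hle : Subalgebra.toSubmodule (Algebra.adjoin k (Set.range j)) ≤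
      Submodule.span k (j '' s) := by
    rw [Algebra.adjoin_eq_span]
    refine Submodule.span_le.mpr fun z hz ↦ ?_
    have hcl : Submonoid.closure (Set.range j) ≤ MonoidHom.mrange (j : A →* κ) :=
      Submonoid.closure_le.mpr fun _ h ↦ h
    obtain ⟨r, rfl⟩ := hcl hz
    exact hmem r
  have : FiniteDimensional k (Submodule.span k (j '' s)) :=
    FiniteDimensional.span_of_finite _ (s.finite_toSet.image j)
  exact Submodule.finiteDimensional_of_le hle

section ResidueField

variable {k₀ L κ : Type*} [Field k₀] [Field L] [Algebra (PS2 k₀) L] [Field κ] [Algebra k₀⸨X⸩ κ]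
  (ρ : CoordRing k₀ L →ₐ[k₀⸨X⸩] κ)

/-- The restriction to `k₀[[x, y]]` of a point of `Spec B[x⁻¹]`. -/
def baseHom : PS2 k₀ →+* κ := (ρ : CoordRing k₀ L →+* κ).comp (algebraMap _ _)

/-- The restriction to `B` of a point of `Spec B[x⁻¹]`. -/
def integralHom : integralClosure (PS2 k₀) L →+* κ :=
  (ρ : CoordRing k₀ L →+* κ).comp (algebraMap _ _)

theorem integralHom_algebraMap (r : PS2 k₀) :
    integralHom ρ (algebraMap (PS2 k₀) (integralClosure (PS2 k₀) L) r) = baseHom ρ r := by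
  simp only [integralHom, baseHom, RingHom.comp_apply]
  rw [← IsScalarTower.algebraMap_apply]

theorem baseHom_inclX (c : k₀⟦X⟧) :
    baseHom ρ (inclX k₀ c) = algebraMap k₀⸨X⸩ κ (algebraMap k₀⟦X⟧ k₀⸨X⸩ c) := by
  rw [← ρ.commutes]
  change ρ _ = ρ (structureMap k₀ L _)
  rw [structureMap, IsLocalization.Away.lift_eq]
  rfl

theorem baseHom_X_zero_ne_zero : baseHom ρ (MvPowerSeries.X 0) ≠ 0 := by
  rw [← inclX_X, baseHom_inclX]
  simp

theorem exists_integralHom_eq (hρ : Function.Surjective ρ) (z : κ) :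
    ∃ (n : ℕ) (b : integralClosure (PS2 k₀) L),
      integralHom ρ b = z * baseHom ρ (MvPowerSeries.X 0) ^ n := by
  obtain ⟨t, rfl⟩ := hρ z
  obtain ⟨n, b, h⟩ := IsLocalization.Away.surj
    (algebraMap (PS2 k₀) (integralClosure (PS2 k₀) L) (MvPowerSeries.X 0)) t
  refine ⟨n, b, ?_⟩
  rw [← integralHom_algebraMap]
  simp only [integralHom, RingHom.comp_apply, ← h, map_mul, map_pow, RingHom.coe_coe]

/-- A closed point does not lie over the generic point of `Spec k₀[[x, y]]`. -/
theorem ker_baseHom_ne_bot (hρ : Function.Surjective ρ) : RingHom.ker (baseHom ρ) ≠ ⊥ := by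
  intro hbot
  have hinj : Function.Injective (baseHom ρ) := (RingHom.injective_iff_ker_eq_bot _).mpr hbot
  -- Specialisation at `y = 0`.
  let θ : PS2 k₀ →+* k₀⟦X⟧ :=
    (PowerSeries.constantCoeff (R := k₀⟦X⟧)).comp (iteratedEquiv k₀ : PS2 k₀ →+* _)
  have hθ0 : θ (MvPowerSeries.X 0) = PowerSeries.X := by
    change PowerSeries.constantCoeff (iteratedEquiv k₀ _) = _
    rw [iteratedEquiv_X_zero, PowerSeries.constantCoeff_C]
  have hθ1 : θ (MvPowerSeries.X 1) = 0 := by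
    change PowerSeries.constantCoeff (iteratedEquiv k₀ _) = _
    rw [iteratedEquiv_X_one, PowerSeries.constantCoeff_X]
  have hy : baseHom ρ (MvPowerSeries.X 1) ≠ 0 := by
    rw [map_ne_zero_iff _ hinj]
    intro h
    have := congrArg (iteratedEquiv k₀) h
    rw [iteratedEquiv_X_one, map_zero] at this
    exact PowerSeries.X_ne_zero this
  obtain ⟨n, b, hb⟩ := exists_integralHom_eq ρ hρ (baseHom ρ (MvPowerSeries.X 1))⁻¹
  obtain ⟨P, hPm, hP⟩ := integralClosure.isIntegral (R := PS2 k₀) b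
  have hP' : P.eval₂ (baseHom ρ) (integralHom ρ b) = 0 := by
    have := congrArg (integralHom ρ) hP
    rw [Polynomial.hom_eval₂, map_zero] at this
    rw [← this]
    exact congrArg (fun φ ↦ P.eval₂ φ (integralHom ρ b))
      (RingHom.ext fun r ↦ (integralHom_algebraMap ρ r).symm)
  -- Scaling the roots by `y` turns the equation of `xⁿ / y` into a monic one for `xⁿ` over `k₀[[x,
  -- y]]`. At `y = 0` only the leading term remains, so a power of `x` would vanish.
  have h1 := Polynomial.scaleRoots_eval₂_eq_zero (baseHom ρ) (s := MvPowerSeries.X 1) hP'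
  rw [hb, mul_inv_cancel_left₀ hy, ← map_pow, Polynomial.eval₂_at_apply] at h1
  have h2 := congrArg θ ((map_eq_zero_iff _ hinj).mp h1)
  rw [← Polynomial.eval₂_at_apply, ← Polynomial.eval_map, Polynomial.map_scaleRoots _ _ _ (by
    simp [hPm.leadingCoeff]), hθ1, Polynomial.scaleRoots_zero, (hPm.map θ).leadingCoeff] at h2
  simp [hθ0] at h2

/-- The subalgebra of the residue field generated by the functions on the base. -/
def baseSubalgebra : Subalgebra k₀⸨X⸩ κ := Algebra.adjoin k₀⸨X⸩ (Set.range (baseHom ρ))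

theorem baseHom_mem_baseSubalgebra (r : PS2 k₀) : baseHom ρ r ∈ baseSubalgebra ρ :=
  Algebra.subset_adjoin ⟨r, rfl⟩

theorem isPrime_comap_ker_baseHom :
    ((RingHom.ker (baseHom ρ)).comap (iteratedEquiv k₀).symm).IsPrime :=
  (RingHom.ker_isPrime (baseHom ρ)).comap _

theorem X_notMem_comap_ker_baseHom : PowerSeries.C PowerSeries.X ∉
    (RingHom.ker (baseHom ρ)).comap (iteratedEquiv k₀).symm := by
  rw [Ideal.mem_comap, ← iteratedEquiv_X_zero, AlgEquiv.symm_apply_apply]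
  exact baseHom_X_zero_ne_zero ρ

theorem comap_ker_baseHom_ne_bot (hρ : Function.Surjective ρ) :
    (RingHom.ker (baseHom ρ)).comap (iteratedEquiv k₀).symm ≠ ⊥ := by
  obtain ⟨r, hr, hr0⟩ := Submodule.exists_mem_ne_zero_of_ne_bot (ker_baseHom_ne_bot ρ hρ)
  intro h
  have : iteratedEquiv k₀ r ∈ (RingHom.ker (baseHom ρ)).comap (iteratedEquiv k₀).symm := by
    rw [Ideal.mem_comap, AlgEquiv.symm_apply_apply]
    exact hr
  rw [h, Ideal.mem_bot, EmbeddingLike.map_eq_zero_iff] at this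
  exact hr0 this

theorem finite_baseSubalgebra (hρ : Function.Surjective ρ) :
    Module.Finite k₀⸨X⸩ (baseSubalgebra ρ) := by
  have := isPrime_comap_ker_baseHom ρ
  have hfin := finite_quotient_of_X_notMem (X_notMem_comap_ker_baseHom ρ)
    (comap_ker_baseHom_ne_bot ρ hρ)
  let Q := (RingHom.ker (baseHom ρ)).comap (iteratedEquiv k₀).symm
  let j : PowerSeries k₀⟦X⟧ ⧸ Q →+* κ := Ideal.Quotient.lift Q
    ((baseHom ρ).comp ((iteratedEquiv k₀).symm : PowerSeries k₀⟦X⟧ →+* PS2 k₀)) fun a ha ↦ ha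
  have hj : ∀ r, j (Ideal.Quotient.mk Q (iteratedEquiv k₀ r)) = baseHom ρ r := by
    intro r
    change baseHom ρ ((iteratedEquiv k₀).symm (iteratedEquiv k₀ r)) = _
    rw [AlgEquiv.symm_apply_apply]
  have hrange : Set.range (baseHom ρ) = Set.range j := by
    refine subset_antisymm (Set.range_subset_iff.mpr fun r ↦ ⟨_, hj r⟩)
      (Set.range_subset_iff.mpr fun a ↦ ?_)
    obtain ⟨F, rfl⟩ := Ideal.Quotient.mk_surjective a
    exact ⟨(iteratedEquiv k₀).symm F, rfl⟩
  rw [baseSubalgebra, hrange]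
  refine finite_adjoin_range hfin (algebraMap k₀⟦X⟧ k₀⸨X⸩) j fun c ↦ ?_
  rw [← baseHom_inclX ρ, ← hj, iteratedEquiv_inclX]
  rfl

variable [Algebra (LS2 k₀) L] [IsScalarTower (PS2 k₀) (LS2 k₀) L]

/-- A relation over `k₀[[x, y]]` can be divided by `q` until some coefficient is not divisible by
`q`. Its image in `κ` is then a nontrivial relation among the `b i`, the powers of `x` being nonzero
there. -/
theorem linearIndependent_of_integralHom (hρ : Function.Surjective ρ) {ι : Type*} [Fintype ι]
    (b : ι → κ) (hb : LinearIndependent (baseSubalgebra ρ) b) (n : ι → ℕ)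
    (β : ι → integralClosure (PS2 k₀) L)
    (hβ : ∀ i, integralHom ρ (β i) = b i * baseHom ρ (MvPowerSeries.X 0) ^ n i) :
    LinearIndependent (LS2 k₀) fun i ↦ (β i : L) := by
  have := isPrime_comap_ker_baseHom ρ
  obtain ⟨q', hq'⟩ := exists_eq_span_of_X_notMem (X_notMem_comap_ker_baseHom ρ)
    (comap_ker_baseHom_ne_bot ρ hρ)
  let q : PS2 k₀ := (iteratedEquiv k₀).symm q'
  have hq : ∀ r, baseHom ρ r = 0 ↔ q ∣ r := by
    intro r
    have h : iteratedEquiv k₀ r ∈ (RingHom.ker (baseHom ρ)).comap (iteratedEquiv k₀).symm ↔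
        q' ∣ iteratedEquiv k₀ r := by rw [hq', Ideal.mem_span_singleton]
    rw [Ideal.mem_comap, AlgEquiv.symm_apply_apply, RingHom.mem_ker] at h
    rw [h, ← map_dvd_iff (iteratedEquiv k₀).symm, AlgEquiv.symm_apply_apply]
  have hqu : ¬ IsUnit q := fun h ↦
    (h.map (baseHom ρ)).ne_zero ((hq q).mpr dvd_rfl)
  have hinjL : Function.Injective (algebraMap (PS2 k₀) L) := by
    rw [IsScalarTower.algebraMap_eq (PS2 k₀) (LS2 k₀) L]
    exact (algebraMap (LS2 k₀) L).injective.comp (IsFractionRing.injective _ _)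
  have hq0 : q ≠ 0 := by
    rintro h0
    refine ker_baseHom_ne_bot ρ hρ ((Submodule.eq_bot_iff _).mpr fun r hr ↦ ?_)
    rw [RingHom.mem_ker, hq, h0, zero_dvd_iff] at hr
    exact hr
  rw [← LinearIndependent.iff_fractionRing (R := PS2 k₀), Fintype.linearIndependent_iff]
  intro c hc
  by_contra! hne
  obtain ⟨i₀, hi₀⟩ := hne
  have : IsDomain (PS2 k₀) := NoZeroDivisors.to_isDomain _
  obtain ⟨m, u, hu, j, hj⟩ := exists_eq_pow_mul_and_exists_not_dvd hqu (c := c)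
    (fun h ↦ hi₀ (congrFun h i₀))
  have hsum : ∑ i, algebraMap (PS2 k₀) (integralClosure (PS2 k₀) L) (u i) * β i = 0 := by
    have h1 : algebraMap (PS2 k₀) L (q ^ m) * ∑ i, algebraMap (PS2 k₀) L (u i) * (β i : L) = 0 := by
      rw [← hc, Finset.mul_sum]
      refine Finset.sum_congr rfl fun i _ ↦ ?_
      rw [Algebra.smul_def, hu, map_mul, mul_assoc]
    have h2 := (mul_eq_zero.mp h1).resolve_left
      ((map_ne_zero_iff _ hinjL).mpr (pow_ne_zero m hq0))
    refine Subtype.ext ?_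
    simpa using h2
  have hκ := congrArg (integralHom ρ) hsum
  rw [map_sum, map_zero] at hκ
  have hκ' : ∑ i, (⟨baseHom ρ (u i * MvPowerSeries.X 0 ^ n i), baseHom_mem_baseSubalgebra ρ _⟩ :
      baseSubalgebra ρ) • b i = 0 := by
    rw [← hκ]
    refine Finset.sum_congr rfl fun i _ ↦ ?_
    change baseHom ρ _ * b i = _
    rw [map_mul, map_pow, map_mul, integralHom_algebraMap, hβ]
    ring
  have h0 := congrArg Subtype.val (Fintype.linearIndependent_iff.mp hb _ hκ' j)
  change baseHom ρ _ = 0 at h0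
  rw [map_mul, map_pow] at h0
  exact hj ((hq _).mp ((mul_eq_zero.mp h0).resolve_right
    (pow_ne_zero _ (baseHom_X_zero_ne_zero ρ))))

/-- The residue field at a closed point of `Spec B[x⁻¹]` is finite over `k₀((x))`. -/
theorem finiteDimensional_of_surjective [FiniteDimensional (LS2 k₀) L]
    (hρ : Function.Surjective ρ) : FiniteDimensional k₀⸨X⸩ κ := by
  have hfin := finite_baseSubalgebra ρ hρ
  -- A domain of finite dimension over a field is a field.
  let : Field (baseSubalgebra ρ) := fieldOfFiniteDimensional k₀⸨X⸩ (baseSubalgebra ρ)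
  have hrank : Module.rank (baseSubalgebra ρ) κ ≤ (Module.finrank (LS2 k₀) L : ℕ) := by
    refine rank_le fun s hs ↦ ?_
    choose n β hβ using fun i : s ↦ exists_integralHom_eq ρ hρ (i : κ)
    simpa using (linearIndependent_of_integralHom ρ hρ _ hs n β hβ).fintype_card_le_finrank
  have : Module.Finite (baseSubalgebra ρ) κ :=
    Module.rank_lt_aleph0_iff.mp (hrank.trans_lt Cardinal.natCast_lt_aleph0)
  exact Module.Finite.trans (baseSubalgebra ρ) κ

end ResidueField

/-! ### Valuation topologies and conclusion -/

theorem isRankOneDiscrete_laurentSeries (k₀ : Type*) [Field k₀] :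
    (Valued.v : Valuation k₀⸨X⸩ _).IsRankOneDiscrete :=
  Valuation.IsRankOneDiscrete.mk' ((PowerSeries.idealX k₀).valuation k₀⸨X⸩)

/-- Over a complete field, a basis gives a linear homeomorphism with `𝕜ⁿ`. Thus a norm on the
residue field induces the topology used to define its points. -/
theorem isModuleTopology_of_finiteDimensional (𝕜 E : Type*) [NontriviallyNormedField 𝕜]
    [CompleteSpace 𝕜] [NormedAddCommGroup E] [NormedSpace 𝕜 E] [FiniteDimensional 𝕜 E] :
    IsModuleTopology 𝕜 E :=
  IsModuleTopology.iso (Module.finBasis 𝕜 E).equivFunL.symm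

end ImplicitFunction

end

open ImplicitFunction in
theorem proposition2 (k₀ : Type*) [Field k₀] [PerfectField k₀]
    (K : Type*) [Field K] [Algebra (PS2 k₀) K] [Algebra (LS2 k₀) K]
    [IsScalarTower (PS2 k₀) (LS2 k₀) K] [FiniteDimensional (LS2 k₀) K]
    (L : Type*) [Field L] [Algebra (PS2 k₀) L] [Algebra K L]
    [IsScalarTower (PS2 k₀) K L] [FiniteDimensional K L]
    (v : PrimeSpectrum (CoordRing k₀ L)) (hv : v.asIdeal.IsMaximal)
    (hf : IsEtaleAtPoint (coordMap k₀ K L).toRingHom v) :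
    FiniteDimensional k₀⸨X⸩ v.asIdeal.ResidueField ∧
      IsLocalHomeomorphOn
        (Points.map (ℓ := v.asIdeal.ResidueField) (coordMap k₀ K L))
        {Points.ofPrime k₀⸨X⸩ v} := by
  have hfin : FiniteDimensional k₀⸨X⸩ v.asIdeal.ResidueField := by
    let : Algebra (LS2 k₀) L := ((algebraMap K L).comp (algebraMap (LS2 k₀) K)).toAlgebra
    have : IsScalarTower (LS2 k₀) K L := IsScalarTower.of_algebraMap_eq fun _ ↦ rfl
    have : IsScalarTower (PS2 k₀) (LS2 k₀) L := IsScalarTower.of_algebraMap_eq fun r ↦ by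
      rw [IsScalarTower.algebraMap_apply (PS2 k₀) K L,
        IsScalarTower.algebraMap_apply (PS2 k₀) (LS2 k₀) K]
      rfl
    have : FiniteDimensional (LS2 k₀) L := Module.Finite.trans K L
    exact finiteDimensional_of_surjective
      (IsScalarTower.toAlgHom k₀⸨X⸩ (CoordRing k₀ L) v.asIdeal.ResidueField)
      v.asIdeal.algebraMap_residueField_surjective
  refine ⟨hfin, ?_⟩
  have := isRankOneDiscrete_laurentSeries k₀
  let : (Valued.v : Valuation k₀⸨X⸩ _).RankOne :=
    -- The base 2 of the absolute value is an arbitrary choice greater than 1.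
    Valuation.IsRankOneDiscrete.rankOne _ (e := 2) (by norm_num)
  let : NontriviallyNormedField k₀⸨X⸩ := Valued.toNontriviallyNormedField k₀⸨X⸩ _
  have : IsUltrametricDist k₀⸨X⸩ := inferInstance
  -- The spectral norm extends the absolute value of `k₀((x))` to the finite extension `k(v)`.
  let : NontriviallyNormedField v.asIdeal.ResidueField :=
    spectralNorm.nontriviallyNormedField k₀⸨X⸩ v.asIdeal.ResidueField
  let : NormedAlgebra k₀⸨X⸩ v.asIdeal.ResidueField :=
    spectralNorm.normedAlgebra k₀⸨X⸩ v.asIdeal.ResidueField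
  have : IsModuleTopology k₀⸨X⸩ v.asIdeal.ResidueField :=
    isModuleTopology_of_finiteDimensional _ _
  have : CompleteSpace v.asIdeal.ResidueField := FiniteDimensional.complete k₀⸨X⸩ _
  obtain ⟨g, hg, het⟩ := hf
  refine isLocalHomeomorphOn_map_of_etale (coordMap k₀ K L) (Points.ofPrime k₀⸨X⸩ v) g ?_ het
  change algebraMap _ v.asIdeal.ResidueField g ≠ 0
  rwa [Ne, Ideal.algebraMap_residueField_eq_zero]
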